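/- Let $E$ be a Polish space with Borel $\sigma$-algebra $\mathcal E$, and let $P(x,dy)$ be a Markov transition kernel on $E$ with $n$-step kernels $P_n$; for $x\in E$ let $\mathbb P_x$ be the law on $E^\infty=E^{\{0,1,2,\dots\}}$ of the chain started at $x$. Let $d$ be a metric on $E$ which is bounded and continuous on $E\times E$ for the given topology of $E$ ($d$ need not be complete and need not generate this topology). The chain is called $d$-Feller if $x\mapsto\int f(y)\,P(x,dy)$ is $d$-continuous for every bounded $d$-continuous $f:E\to\mathbb R$. For probability measures $\mu,\nu$ on a measurable space $S$ let $C(\mu,\nu)$ be the set of probability measures $\xi$ on $S\times S$ with marginals $\pi_1(\xi)=\mu$, $\pi_2(\xi)=\nu$, let $\widehat C(\mu,\nu)$ be the set of those with $\pi_1(\xi)\ll\mu$, $\pi_2(\xi)\ll\nu$, and for $p>1$, $R\ge1$ let $\widehat C_p^R(\mu,\nu)$ be the set of $\xi\in\widehat C(\mu,\nu)$ with $$\Big(\int\Big(\frac{d\pi_1(\xi)}{d\mu}\Big)^p d\mu\Big)^{1/p}\le R,\qquad \Big(\int\Big(\frac{d\pi_2(\xi)}{d\nu}\Big)^p d\nu\Big)^{1/p}\le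 R .$$ For probability measures on $E$ put $d(\mu,\nu)=\inf_{\eta\in C(\mu,\nu)}\int d(x,y)\,\eta(dx,dy)$. Write $(X_n,Y_n)_{n\ge0}$ for the coordinates on $E^\infty\times E^\infty$. For $x,y\in E$ consider the conditions (i) $\displaystyle\lim_{\varepsilon\downarrow0}\liminf_{n\to\infty}\sup_{\xi\in C(\mathbb P_x,\mathbb P_y)}\xi\big(d(X_n,Y_n)\le\varepsilon\big)>0$; (ii) for some $p>1$ and $R\ge1$, $\displaystyle\lim_{\varepsilon\downarrow0}\liminf_{n\to\infty}\sup_{\xi\in\widehat C_p^R(\mathbb P_x,\mathbb P_y)}\xi\big(d(X_n,Y_n)\le\varepsilon\big)>0$; (iii) $\displaystyle\sup_{\xi\in\widehat C(\mathbb P_x,\mathbb P_y)}\lim_{\varepsilon\downarrow0}\liminf_{n\to\infty}\xi\big(d(X_n,Y_n)\le\varepsilon\big)>0$. I. Suppose that the chain is $d$-Feller, that $\mu$ is an invariant probability measure, and that there is $M\in\mathcal E\otimes\mathcal E$ with $(\mu\otimes\mu)(M)=1$ such that (i) holds for every $(x,y)\in M$. Then for every $\varepsilon>0$ $$\mu\big(\{x: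 d(P_n(x,\cdot),\mu)>\varepsilon\}\big)\to0\qquad(n\to\infty).$$ II. For all $x,y\in E$, condition (i) is equivalent to condition (ii), and condition (iii) implies (ii) and (i). -/

import Mathlib

open MeasureTheory ProbabilityTheory Filter Topology
open scoped ENNReal

noncomputable section

namespace GenCoupling

/-- `d` is a metric on the set `E`; the topology of `E` need not be the one given by `d`. -/
structure IsMetric {E : Type*} (d : E → E → ℝ) : Prop where
  eq_zero_iff : ∀ x y, d x y = 0 ↔ x = y
  symm : ∀ x y, d x y = d y x
  triangle : ∀ x y z, d x z ≤ d x y + d y z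

/-- Continuity of a real function with respect to the metric `d`. -/
def DContinuous {E : Type*} (d : E → E → ℝ) (f : E → ℝ) : Prop :=
  ∀ x, ∀ ε > 0, ∃ δ > 0, ∀ y, d x y < δ → |f y - f x| < ε

section Couplings

variable {S : Type*} [MeasurableSpace S]

/-- The couplings `C(μ, ν)`. -/
def couplings (μ ν : Measure S) : Set (Measure (S × S)) :=
  {ξ | IsProbabilityMeasure ξ ∧ ξ.fst = μ ∧ ξ.snd = ν}

/-- The generalized couplings `Ĉ(μ, ν)`. -/
def genCouplings (μ ν : Measure S) : Set (Measure (S × S)) :=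
  {ξ | IsProbabilityMeasure ξ ∧ ξ.fst ≪ μ ∧ ξ.snd ≪ ν}

/-- The generalized couplings `Ĉ_p^R(μ, ν)`, whose marginal densities have `L^p` norm at
most `R`. -/
def genCouplingsLp (p R : ℝ) (μ ν : Measure S) : Set (Measure (S × S)) :=
  {ξ | ξ ∈ genCouplings μ ν ∧
    (∫⁻ s, (ξ.fst.rnDeriv μ s) ^ p ∂μ) ^ (1 / p) ≤ ENNReal.ofReal R ∧
    (∫⁻ s, (ξ.snd.rnDeriv ν s) ^ p ∂ν) ^ (1 / p) ≤ ENNReal.ofReal R}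

/-- The minimal (coupling, Kantorovich-Rubinshtein) distance associated with `d`. -/
def minimalDist (d : S → S → ℝ) (μ ν : Measure S) : ℝ≥0∞ :=
  ⨅ η ∈ couplings μ ν, ∫⁻ z, ENNReal.ofReal (d z.1 z.2) ∂η

end Couplings

section Chain

variable {E : Type*} [MeasurableSpace E]

/-- The `n`-step transition probabilities. -/
def nStep (P : Kernel E E) : ℕ → Kernel E E
  | 0 => Kernel.id
  | n + 1 => P ∘ₖ nStep P n

/-- The law on the trajectory space of the Markov chain with transition kernel `P` started
at `x`. -/
def pathLaw (P : Kernel E E) [IsMarkovKernel P] (x : E) : Measure (ℕ → E) :=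
  Kernel.trajMeasure (X := fun _ => E) (Measure.dirac x)
    (fun n => P.comap (fun h : (i : Finset.Iic n) → E => h ⟨n, Finset.mem_Iic.2 le_rfl⟩)
      (measurable_pi_apply _))

/-- The chain is `d`-Feller. -/
def IsDFeller (d : E → E → ℝ) (P : Kernel E E) : Prop :=
  ∀ f : E → ℝ, (∃ C, ∀ x, |f x| ≤ C) → DContinuous d f →
    DContinuous d (fun x => ∫ y, f y ∂(P x))

/-- The event `d(X_n, Y_n) ≤ ε` for a pair of trajectories. -/
def closeAt (d : E → E → ℝ) (n : ℕ) (ε : ℝ) : Set ((ℕ → E) × (ℕ → E)) :=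
  {ω | d (ω.1 n) (ω.2 n) ≤ ε}

/-- `lim_{ε ↓ 0} g ε`; it is only used for monotone `g`, for which the limit exists
(`tendsto_limZero`). -/
def limZero (g : ℝ → ℝ≥0∞) : ℝ≥0∞ :=
  limUnder (𝓝[>] (0 : ℝ)) g

theorem tendsto_limZero {g : ℝ → ℝ≥0∞} (hg : Monotone g) :
    Tendsto g (𝓝[>] (0 : ℝ)) (𝓝 (limZero g)) :=
  tendsto_nhds_limUnder ⟨_, hg.tendsto_nhdsGT 0⟩

/-- The condition over true couplings at the pair of initial points `(x, y)`. -/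
def CouplingCond (d : E → E → ℝ) (P : Kernel E E) [IsMarkovKernel P] (x y : E) : Prop :=
  0 < limZero fun ε => liminf
    (fun n : ℕ => ⨆ ξ ∈ couplings (pathLaw P x) (pathLaw P y), ξ (closeAt d n ε)) atTop

/-- The condition over generalized couplings with `L^p` densities bounded by `R`. -/
def LpCouplingCond (d : E → E → ℝ) (P : Kernel E E) [IsMarkovKernel P] (p R : ℝ) (x y : E) :
    Prop :=
  0 < limZero fun ε => liminf
    (fun n : ℕ => ⨆ ξ ∈ genCouplingsLp p R (pathLaw P x) (pathLaw P y), ξ (closeAt d n ε)) atTop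

/-- The condition over all generalized couplings, with the supremum outside the limits. -/
def GenCouplingCond (d : E → E → ℝ) (P : Kernel E E) [IsMarkovKernel P] (x y : E) : Prop :=
  0 < ⨆ ξ ∈ genCouplings (pathLaw P x) (pathLaw P y),
    limZero fun ε => liminf (fun n : ℕ => ξ (closeAt d n ε)) atTop

end Chain

end GenCoupling

end

/-!
For a bounded `d`-continuous function `f`, stationarity makes the `L²(μ)` norms of `P_m f` decrease,
and their successive losses sum to a finite quantity. The loss from `m` to `m + n` is the mean
conditional variance of `P_m f` under `P_n`, so for large `m` the function `P_m f` deviates little,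
on `μ`-average, from `P_{m+n} f (x)` under `P_n(x, ·)`, uniformly in `n`. A coupling giving mass `a`
to nearby pairs at time `n` therefore makes `a |P_{m+n} f (x) - P_{m+n} f (y)|` small for typical
pairs `(x, y)`, and averaging over `y` shows that `P_n f → ∫ f dμ` in `L¹(μ)`. A countable partition
of unity into functions of small `d`-diameter turns this into a bound for the minimal distance.

A generalized coupling whose marginal densities are truncated at `N` and divided by `N` becomes a
sub-coupling, which extends to a coupling by independent completion; the tails of the densities
control the mass lost.
-/

open scoped BoundedContinuousFunction

namespace GenCoupling

section Couplings

variable {S T : Type*} [MeasurableSpace S] [MeasurableSpace T]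

theorem exists_marginals_le (μ : Measure S) (ν : Measure T) [IsFiniteMeasure μ]
    [IsFiniteMeasure ν] :
    ∃ ζ : Measure (S × T), ζ.fst ≤ μ ∧ ζ.snd ≤ ν ∧ ζ .univ = min (μ .univ) (ν .univ) := by
  set m := max (μ .univ) (ν .univ) with hm
  rcases eq_or_ne m 0 with h0 | h0
  · obtain ⟨hμ, hν⟩ : μ .univ = 0 ∧ ν .univ = 0 := max_eq_bot.1 h0
    exact ⟨0, by simp [hμ, hν, Measure.zero_le]⟩
  have ht : m ≠ ∞ := max_ne_top (measure_ne_top μ _) (measure_ne_top ν _)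
  have hle {c : ℝ≥0∞} (hc : c ≤ m) : m⁻¹ * c ≤ 1 :=
    (mul_le_mul_right hc _).trans_eq (ENNReal.inv_mul_cancel h0 ht)
  refine ⟨m⁻¹ • μ.prod ν, ?_, ?_, ?_⟩
  · rw [Measure.fst, Measure.map_smul, Measure.map_fst_prod, smul_smul]
    exact Measure.le_iff'.2 fun s => mul_le_of_le_one_left' (hle (le_max_right _ _))
  · rw [Measure.snd, Measure.map_smul, Measure.map_snd_prod, smul_smul]
    exact Measure.le_iff'.2 fun s => mul_le_of_le_one_left' (hle (le_max_left _ _))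
  · rw [Measure.smul_apply, ← Set.univ_prod_univ, Measure.prod_prod, smul_eq_mul,
      ← min_mul_max (μ .univ), ← hm, mul_comm, mul_assoc, ENNReal.mul_inv_cancel h0 ht, mul_one]

variable {μ ν : Measure S}

theorem exists_coupling_ge [IsProbabilityMeasure μ] [IsProbabilityMeasure ν]
    {ζ : Measure (S × S)} (h₁ : ζ.fst ≤ μ) (h₂ : ζ.snd ≤ ν) :
    ∃ η ∈ couplings μ ν, ζ ≤ η := by
  have := isFiniteMeasure_of_le μ h₁
  have := isFiniteMeasure_of_le ν h₂
  have e₁ : (μ - ζ.fst) .univ = 1 - ζ .univ := by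
    rw [Measure.sub_apply .univ h₁, measure_univ, Measure.fst_univ]
  have e₂ : (ν - ζ.snd) .univ = 1 - ζ .univ := by
    rw [Measure.sub_apply .univ h₂, measure_univ, Measure.snd_univ]
  obtain ⟨θ, hθ₁, hθ₂, hθ⟩ := exists_marginals_le (μ - ζ.fst) (ν - ζ.snd)
  rw [e₁, e₂, min_self] at hθ
  have := isFiniteMeasure_of_le _ hθ₁
  have := isFiniteMeasure_of_le _ hθ₂
  have f₁ : θ.fst = μ - ζ.fst :=
    Measure.eq_of_le_of_measure_univ_eq hθ₁ (by rw [Measure.fst_univ, hθ, e₁])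
  have f₂ : θ.snd = ν - ζ.snd :=
    Measure.eq_of_le_of_measure_univ_eq hθ₂ (by rw [Measure.snd_univ, hθ, e₂])
  have m₁ : (θ + ζ).fst = μ := by
    rw [Measure.fst_add, f₁, Measure.sub_add_cancel_of_le h₁]
  have m₂ : (θ + ζ).snd = ν := by
    rw [Measure.snd_add, f₂, Measure.sub_add_cancel_of_le h₂]
  refine ⟨θ + ζ, ⟨⟨?_⟩, m₁, m₂⟩, Measure.le_add_left le_rfl⟩
  rw [← Measure.fst_univ, m₁, measure_univ]

theorem couplings_subset_genCouplingsLp [SigmaFinite μ] [SigmaFinite ν] {p R : ℝ} (hR : 1 ≤ R) :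
    couplings μ ν ⊆ genCouplingsLp p R μ ν := by
  have norm_rnDeriv_self (ρ : Measure S) [IsProbabilityMeasure ρ] :
      (∫⁻ s, ρ.rnDeriv ρ s ^ p ∂ρ) ^ (1 / p) ≤ ENNReal.ofReal R := by
    have h : (fun s => ρ.rnDeriv ρ s ^ p) =ᵐ[ρ] fun _ => 1 :=
      (Measure.rnDeriv_self ρ).mono fun s hs => by simp [hs]
    simpa [lintegral_congr_ae h] using hR
  rintro ξ ⟨hξ, rfl, rfl⟩
  exact ⟨⟨hξ, .rfl, .rfl⟩, norm_rnDeriv_self _, norm_rnDeriv_self _⟩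

theorem restrict_rnDeriv_le_le_smul [SFinite μ] [SigmaFinite ν] (h : μ ≪ ν)
    (N : ℝ≥0∞) : μ.restrict {s | μ.rnDeriv ν s ≤ N} ≤ N • ν := by
  refine Measure.le_iff.2 fun t ht => ?_
  rw [Measure.restrict_apply ht, ← Measure.setLIntegral_rnDeriv h]
  calc ∫⁻ s in t ∩ {s | μ.rnDeriv ν s ≤ N}, μ.rnDeriv ν s ∂ν
      ≤ ∫⁻ _ in t ∩ {s | μ.rnDeriv ν s ≤ N}, N ∂ν :=
        setLIntegral_mono measurable_const fun s hs => hs.2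
    _ = N * ν (t ∩ {s | μ.rnDeriv ν s ≤ N}) := setLIntegral_const _ _
    _ ≤ N * ν t := by gcongr; exact Set.inter_subset_left

theorem exists_coupling_smul_ge [IsProbabilityMeasure μ] [IsProbabilityMeasure ν]
    {ζ : Measure (S × S)} {N : ℝ≥0∞} (hN : N ≠ 0) (hN' : N ≠ ∞) (h₁ : ζ.fst ≤ N • μ)
    (h₂ : ζ.snd ≤ N • ν) : ∃ η ∈ couplings μ ν, ζ ≤ N • η := by
  have inv_smul_le {ρ τ : Measure S} (h : ρ ≤ N • τ) : N⁻¹ • ρ ≤ τ :=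
    Measure.le_iff'.2 fun t => by
      have ht : ρ t ≤ N * τ t := Measure.le_iff'.1 h t
      rwa [Measure.smul_apply, smul_eq_mul, ENNReal.inv_mul_le_iff hN hN']
  obtain ⟨η, hη, hle⟩ := exists_coupling_ge (μ := μ) (ν := ν) (ζ := N⁻¹ • ζ)
    (by rw [Measure.fst, Measure.map_smul]; exact inv_smul_le h₁)
    (by rw [Measure.snd, Measure.map_smul]; exact inv_smul_le h₂)
  refine ⟨η, hη, Measure.le_iff'.2 fun s => ?_⟩
  have hs : N⁻¹ * ζ s ≤ η s := Measure.le_iff'.1 hle s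
  rwa [ENNReal.inv_mul_le_iff hN hN'] at hs

/-- The mass that `μ` puts on the set where its density with respect to `ν` exceeds `N`; its decay
as `N → ∞` is what makes the truncation of densities effective. -/
def densityTail (μ ν : Measure S) (N : ℝ≥0∞) : ℝ≥0∞ :=
  μ {s | N < μ.rnDeriv ν s}

theorem exists_coupling_of_genCoupling [IsProbabilityMeasure μ] [IsProbabilityMeasure ν]
    {ξ : Measure (S × S)} (hξ : ξ ∈ genCouplings μ ν) {N : ℝ≥0∞} (hN : N ≠ 0) (hN' : N ≠ ∞) :
    ∃ η ∈ couplings μ ν, ∀ s,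
      ξ s ≤ N * η s + (densityTail ξ.fst μ N + densityTail ξ.snd ν N) := by
  obtain ⟨_, h₁, h₂⟩ := hξ
  set A := {s | ξ.fst.rnDeriv μ s ≤ N} with hA
  set B := {s | ξ.snd.rnDeriv ν s ≤ N} with hB
  have mA : MeasurableSet A := measurableSet_le (Measure.measurable_rnDeriv _ _) measurable_const
  have mB : MeasurableSet B := measurableSet_le (Measure.measurable_rnDeriv _ _) measurable_const
  have f₁ : (ξ.restrict (A ×ˢ B)).fst ≤ ξ.fst.restrict A := by
    rw [Measure.fst, Measure.fst, Measure.restrict_map measurable_fst mA]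
    exact Measure.map_mono (Measure.restrict_mono (fun z hz => hz.1) le_rfl) measurable_fst
  have f₂ : (ξ.restrict (A ×ˢ B)).snd ≤ ξ.snd.restrict B := by
    rw [Measure.snd, Measure.snd, Measure.restrict_map measurable_snd mB]
    exact Measure.map_mono (Measure.restrict_mono (fun z hz => hz.2) le_rfl) measurable_snd
  obtain ⟨η, hη, hle⟩ := exists_coupling_smul_ge hN hN'
    (f₁.trans (restrict_rnDeriv_le_le_smul h₁ N)) (f₂.trans (restrict_rnDeriv_le_le_smul h₂ N))
  have tail₁ : densityTail ξ.fst μ N = ξ (Prod.fst ⁻¹' Aᶜ) := by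
    rw [← Measure.fst_apply mA.compl, densityTail]; congr; ext; simp [hA]
  have tail₂ : densityTail ξ.snd ν N = ξ (Prod.snd ⁻¹' Bᶜ) := by
    rw [← Measure.snd_apply mB.compl, densityTail]; congr; ext; simp [hB]
  refine ⟨η, hη, fun s => ?_⟩
  have hs : s ⊆ (s ∩ A ×ˢ B) ∪ (Prod.fst ⁻¹' Aᶜ ∪ Prod.snd ⁻¹' Bᶜ) := by
    intro z hz
    by_cases h1 : z.1 ∈ A <;> by_cases h2 : z.2 ∈ B <;> simp [hz, h1, h2]
  calc ξ s ≤ ξ (s ∩ A ×ˢ B) + (ξ (Prod.fst ⁻¹' Aᶜ) + ξ (Prod.snd ⁻¹' Bᶜ)) :=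
        (measure_mono hs).trans ((measure_union_le _ _).trans
          (by gcongr; exact measure_union_le _ _))
    _ ≤ N * η s + (densityTail ξ.fst μ N + densityTail ξ.snd ν N) := by
        rw [tail₁, tail₂, ← Measure.restrict_apply' (mA.prod mB)]
        gcongr
        exact Measure.le_iff'.1 hle s

theorem densityTail_le_div [SFinite μ] [SigmaFinite ν] (h : μ ≪ ν) {p : ℝ} (hp : 1 < p)
    {N : ℝ≥0∞} (hN : N ≠ 0) (hN' : N ≠ ∞) :
    densityTail μ ν N ≤ (∫⁻ s, μ.rnDeriv ν s ^ p ∂ν) / N ^ (p - 1) := by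
  have hm := Measure.measurable_rnDeriv μ ν
  have hp' : 0 < p - 1 := sub_pos.2 hp
  rw [ENNReal.le_div_iff_mul_le (.inl (by simp [hN, hN']))
    (.inl (ENNReal.rpow_ne_top_of_nonneg hp'.le hN')), mul_comm, densityTail,
    ← Measure.setLIntegral_rnDeriv h, ← lintegral_const_mul _ hm]
  refine (setLIntegral_mono (hm.pow_const p) fun s (hs : N < μ.rnDeriv ν s) => ?_).trans
    (setLIntegral_le_lintegral _ _)
  calc N ^ (p - 1) * μ.rnDeriv ν s
      ≤ μ.rnDeriv ν s ^ (p - 1) * μ.rnDeriv ν s ^ (1 : ℝ) := by rw [ENNReal.rpow_one]; gcongr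
    _ = μ.rnDeriv ν s ^ p := by
        rw [← ENNReal.rpow_add_of_nonneg _ _ hp'.le zero_le_one, sub_add_cancel]

theorem tendsto_densityTail [IsFiniteMeasure μ] (h : μ ≪ ν) :
    Tendsto (fun N : ℕ => densityTail μ ν N) atTop (𝓝 0) := by
  have hm := Measure.measurable_rnDeriv μ ν
  have h0 : μ (⋂ N : ℕ, {s | (N : ℝ≥0∞) < μ.rnDeriv ν s}) = 0 := by
    refine measure_mono_null (t := {s | ¬ μ.rnDeriv ν s < ∞}) (fun s hs hlt => ?_)
      (h.ae_le (Measure.rnDeriv_lt_top μ ν))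
    obtain ⟨N, hN⟩ := ENNReal.exists_nat_gt (ne_of_lt hlt)
    exact (hN.trans (Set.mem_iInter.1 hs N)).false
  rw [← h0]
  refine tendsto_measure_iInter_atTop
    (fun N => (measurableSet_lt measurable_const hm).nullMeasurableSet) ?_ ⟨0, measure_ne_top _ _⟩
  exact fun K N hKN s (hs : N < μ.rnDeriv ν s) => (Nat.cast_le.2 hKN).trans_lt hs

end Couplings

section Conditions

theorem limZero_eq_iInf {g : ℝ → ℝ≥0∞} (hg : Monotone g) : limZero g = ⨅ ε > 0, g ε := by
  rw [tendsto_nhds_unique (tendsto_limZero hg) (hg.tendsto_nhdsGT 0), sInf_image]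
  rfl

theorem limZero_liminf_pos_iff {u : ℝ → ℕ → ℝ≥0∞} (hu : ∀ n, Monotone fun ε => u ε n) :
    0 < limZero (fun ε => liminf (u ε) atTop) ↔
      ∃ a, a ≠ 0 ∧ a ≠ ∞ ∧ ∀ ε > 0, ∀ᶠ n in atTop, a ≤ u ε n := by
  have hm : Monotone fun ε => liminf (u ε) atTop := fun ε ε' h =>
    liminf_le_liminf (Eventually.of_forall fun n => hu n h)
  rw [limZero_eq_iInf hm]
  constructor
  · intro h
    obtain ⟨a, ha, ha'⟩ := exists_between h
    refine ⟨a, ha.ne', ha'.ne_top, fun ε hε => ?_⟩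
    have : a < liminf (u ε) atTop := ha'.trans_le (iInf₂_le ε hε)
    exact (eventually_lt_of_lt_liminf this).mono fun n hn => hn.le
  · rintro ⟨a, ha, -, h⟩
    exact (pos_iff_ne_zero.2 ha).trans_le
      (le_iInf₂ fun ε hε => le_liminf_of_le (by isBoundedDefault) (h ε hε))

theorem closeAt_mono {E : Type*} {d : E → E → ℝ} (n : ℕ) : Monotone fun ε => closeAt d n ε :=
  fun _ _ h _ hω => le_trans hω h

variable {E : Type*} [MeasurableSpace E] {d : E → E → ℝ}

theorem limZero_iSup_pos_iff {𝒞 : Set (Measure ((ℕ → E) × (ℕ → E)))} :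
    (0 < limZero fun ε => liminf (fun n : ℕ => ⨆ ξ ∈ 𝒞, ξ (closeAt d n ε)) atTop) ↔
      ∃ a, a ≠ 0 ∧ a ≠ ∞ ∧ ∀ ε > 0, ∀ᶠ n in atTop, a ≤ ⨆ ξ ∈ 𝒞, ξ (closeAt d n ε) :=
  limZero_liminf_pos_iff (u := fun ε n => ⨆ ξ ∈ 𝒞, ξ (closeAt d n ε)) fun n _ _ h =>
    iSup₂_mono fun _ _ => measure_mono (closeAt_mono n h)

variable {P : Kernel E E} [IsMarkovKernel P] {x y : E}

instance : IsProbabilityMeasure (pathLaw P x) := by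
  unfold pathLaw
  infer_instance

theorem CouplingCond.lpCouplingCond (h : CouplingCond d P x y) {p R : ℝ} (hR : 1 ≤ R) :
    LpCouplingCond d P p R x y := by
  obtain ⟨a, ha, ha', h⟩ := limZero_iSup_pos_iff.1 h
  exact limZero_iSup_pos_iff.2 ⟨a, ha, ha', fun ε hε => (h ε hε).mono fun n hn =>
    hn.trans (biSup_mono fun _ hξ => couplings_subset_genCouplingsLp hR hξ)⟩

theorem couplingCond_of_tendsto_densityTail {𝒞 : Set (Measure ((ℕ → E) × (ℕ → E)))}
    (h𝒞 : 𝒞 ⊆ genCouplings (pathLaw P x) (pathLaw P y))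
    (htail : Tendsto (fun N : ℕ => ⨆ ξ ∈ 𝒞,
      (densityTail ξ.fst (pathLaw P x) N + densityTail ξ.snd (pathLaw P y) N)) atTop (𝓝 0))
    (h : 0 < limZero fun ε => liminf (fun n : ℕ => ⨆ ξ ∈ 𝒞, ξ (closeAt d n ε)) atTop) :
    CouplingCond d P x y := by
  obtain ⟨a, ha, ha', h⟩ := limZero_iSup_pos_iff.1 h
  have ha2 : a / 2 ≠ 0 := (ENNReal.half_pos ha).ne'
  have ha2' : a / 2 ≠ ∞ := ENNReal.div_ne_top ha' two_ne_zero
  obtain ⟨N, hN, hN0⟩ := ((htail.eventually_le_const (pos_iff_ne_zero.2 ha2)).and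
    (eventually_ne_atTop 0)).exists
  have hN0' : (N : ℝ≥0∞) ≠ 0 := Nat.cast_ne_zero.2 hN0
  have hNt : (N : ℝ≥0∞) ≠ ∞ := ENNReal.natCast_ne_top N
  refine limZero_iSup_pos_iff.2 ⟨a / 2 / N, ENNReal.div_ne_zero.2 ⟨ha2, hNt⟩,
    ENNReal.div_ne_top ha2' hN0', fun ε hε => (h ε hε).mono fun n hn => ?_⟩
  set K := ⨆ ξ ∈ couplings (pathLaw P x) (pathLaw P y), ξ (closeAt d n ε)
  have hle : a / 2 + a / 2 ≤ N * K + a / 2 := by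
    rw [ENNReal.add_halves]
    refine hn.trans (iSup₂_le fun ξ hξ => ?_)
    obtain ⟨η, hη, hs⟩ := exists_coupling_of_genCoupling (h𝒞 hξ) hN0' hNt
    refine (hs _).trans (add_le_add ?_ ((le_biSup _ hξ).trans hN))
    gcongr
    exact le_biSup (fun η : Measure _ => η (closeAt d n ε)) hη
  rw [ENNReal.div_le_iff' hN0' hNt]
  exact (ENNReal.add_le_add_iff_right ha2').1 hle

theorem LpCouplingCond.couplingCond {p R : ℝ} (hp : 1 < p) (h : LpCouplingCond d P p R x y) :
    CouplingCond d P x y := by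
  have hp0 : 0 < p := zero_lt_one.trans hp
  set c := ENNReal.ofReal R ^ p
  have hc : c ≠ ∞ := ENNReal.rpow_ne_top_of_nonneg hp0.le ENNReal.ofReal_ne_top
  have tail_le {μ ν : Measure (ℕ → E)} [IsFiniteMeasure μ] [SigmaFinite ν] (hμ : μ ≪ ν)
      (hR : (∫⁻ s, μ.rnDeriv ν s ^ p ∂ν) ^ (1 / p) ≤ ENNReal.ofReal R) {N : ℕ} (hN : N ≠ 0) :
      densityTail μ ν N ≤ c / (N : ℝ≥0∞) ^ (p - 1) := by
    refine (densityTail_le_div hμ hp (Nat.cast_ne_zero.2 hN) (ENNReal.natCast_ne_top N)).trans ?_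
    gcongr
    rwa [one_div, ENNReal.rpow_inv_le_iff hp0] at hR
  have htend : Tendsto (fun N : ℕ => c / (N : ℝ≥0∞) ^ (p - 1) + c / (N : ℝ≥0∞) ^ (p - 1))
      atTop (𝓝 0) := by
    have h1 : Tendsto (fun N : ℕ => c / (N : ℝ≥0∞) ^ (p - 1)) atTop (𝓝 0) := by
      rw [← ENNReal.div_top (a := c)]
      exact ENNReal.Tendsto.const_div ((ENNReal.tendsto_rpow_at_top (sub_pos.2 hp)).comp
        ENNReal.tendsto_nat_nhds_top) (.inr hc)
    simpa using h1.add h1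
  refine couplingCond_of_tendsto_densityTail (fun ξ hξ => hξ.1)
    (tendsto_of_tendsto_of_tendsto_of_le_of_le' tendsto_const_nhds htend (by simp) ?_) h
  filter_upwards [eventually_ne_atTop 0] with N hN
  refine iSup₂_le fun ξ ⟨⟨_, h₁, h₂⟩, hR₁, hR₂⟩ => ?_
  exact add_le_add (tail_le h₁ hR₁ hN) (tail_le h₂ hR₂ hN)

theorem GenCouplingCond.couplingCond (h : GenCouplingCond d P x y) : CouplingCond d P x y := by
  obtain ⟨ξ, hξ⟩ := lt_iSup_iff.1 h
  obtain ⟨hξC, hpos⟩ := lt_iSup_iff.1 hξ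
  obtain ⟨_, h₁, h₂⟩ := id hξC
  refine couplingCond_of_tendsto_densityTail (𝒞 := {ξ}) (Set.singleton_subset_iff.2 hξC) ?_ ?_
  · simpa using (tendsto_densityTail h₁).add (tendsto_densityTail h₂)
  · simpa using hpos

end Conditions

section Chain

variable {E : Type*} [MeasurableSpace E] {P : Kernel E E}

theorem invariant_nStep {μ : Measure E} (h : P.Invariant μ) (n : ℕ) :
    (nStep P n).Invariant μ := by
  induction n with
  | zero => exact Measure.id_comp
  | succ n ih => exact h.comp ih

variable [IsMarkovKernel P]

instance (n : ℕ) : IsMarkovKernel (nStep P n) := by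
  induction n with
  | zero => exact inferInstanceAs (IsMarkovKernel Kernel.id)
  | succ n ih => exact inferInstanceAs (IsMarkovKernel (P ∘ₖ nStep P n))

theorem map_eval_zero_pathLaw (x : E) : (pathLaw P x).map (fun ω => ω 0) = Measure.dirac x := by
  have h0 : (pathLaw P x).map (Preorder.frestrictLe 0) =
      (Measure.dirac x).map (MeasurableEquiv.piUnique (fun _ : Finset.Iic 0 => E)).symm := by
    rw [pathLaw, Kernel.trajMeasure, Measure.map_comp _ _ (by fun_prop),
      Kernel.traj_map_frestrictLe, Kernel.partialTraj_self]
    exact Measure.id_comp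
  have eval_eq : (fun ω : ℕ → E => ω 0) =
      (fun h : Finset.Iic 0 → E => h ⟨0, Finset.mem_Iic.2 le_rfl⟩) ∘ Preorder.frestrictLe 0 := rfl
  rw [eval_eq, ← Measure.map_map (by fun_prop) (by fun_prop), h0,
    Measure.map_map (by fun_prop) (by fun_prop),
    Measure.map_dirac' ((measurable_pi_apply _).comp (MeasurableEquiv.measurable _)) x]
  rfl

theorem map_eval_succ_pathLaw (x : E) (n : ℕ) :
    (pathLaw P x).map (fun ω => ω (n + 1)) = P ∘ₘ (pathLaw P x).map (fun ω => ω n) := by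
  have h := congrArg Measure.snd <| Kernel.map_frestrictLe_trajMeasure_compProd_eq_map_trajMeasure
    (X := fun _ => E) (μ₀ := Measure.dirac x)
    (κ := fun n => P.comap (fun h : (i : Finset.Iic n) → E => h ⟨n, Finset.mem_Iic.2 le_rfl⟩)
      (measurable_pi_apply _)) (a := n)
  rw [Measure.snd_compProd, Measure.snd, Measure.map_map (by fun_prop) (by fun_prop),
    ← Kernel.comp_deterministic_eq_comap, ← Measure.comp_assoc,
    Measure.deterministic_comp_eq_map, Measure.map_map (by fun_prop) (by fun_prop)] at h
  exact h.symm

theorem map_eval_pathLaw (x : E) (n : ℕ) :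
    (pathLaw P x).map (fun ω => ω n) = nStep P n x := by
  induction n with
  | zero => exact (map_eval_zero_pathLaw x).trans (Kernel.id_apply x).symm
  | succ n ih => rw [map_eval_succ_pathLaw, ih]; exact (Kernel.comp_apply _ _ _).symm

theorem iSup_closeAt_le (d : E → E → ℝ) (x y : E) (n : ℕ) (ε : ℝ) :
    ⨆ ξ ∈ couplings (pathLaw P x) (pathLaw P y), ξ (closeAt d n ε) ≤
      ⨆ η ∈ couplings (nStep P n x) (nStep P n y), η {z | d z.1 z.2 ≤ ε} := by
  refine iSup₂_le fun ξ ⟨_, h₁, h₂⟩ => ?_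
  have hm : Measurable fun ω : (ℕ → E) × (ℕ → E) => (ω.1 n, ω.2 n) := by fun_prop
  refine le_trans (Measure.le_map_apply hm.aemeasurable {z | d z.1 z.2 ≤ ε})
    (le_biSup (fun η : Measure (E × E) => η {z | d z.1 z.2 ≤ ε})
      ⟨Measure.isProbabilityMeasure_map hm.aemeasurable, ?_, ?_⟩)
  · rw [← map_eval_pathLaw, ← h₁, Measure.fst, Measure.fst, Measure.map_map (by fun_prop) hm,
      Measure.map_map (by fun_prop) (by fun_prop)]
    rfl
  · rw [← map_eval_pathLaw, ← h₂, Measure.snd, Measure.snd, Measure.map_map (by fun_prop) hm,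
      Measure.map_map (by fun_prop) (by fun_prop)]
    rfl

end Chain

section MeanDeviation

variable {Ω : Type*} [MeasurableSpace Ω]

theorem sq_lintegral_le_lintegral_sq (ρ : Measure Ω) [IsProbabilityMeasure ρ] (f : Ω → ℝ≥0∞) :
    (∫⁻ ω, f ω ∂ρ) ^ 2 ≤ ∫⁻ ω, f ω ^ 2 ∂ρ := by
  obtain ⟨g, hgm, hgf, hg⟩ := exists_measurable_le_lintegral_eq ρ f
  have holder := ENNReal.lintegral_mul_le_Lp_mul_Lq ρ Real.HolderConjugate.two_two hgm.aemeasurable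
    (aemeasurable_const (b := 1))
  calc (∫⁻ ω, f ω ∂ρ) ^ 2 ≤ ((∫⁻ ω, g ω ^ 2 ∂ρ) ^ (1 / 2 : ℝ)) ^ 2 := by
        rw [hg]
        gcongr
        simpa using holder
    _ = ∫⁻ ω, g ω ^ 2 ∂ρ := by
        rw [← ENNReal.rpow_natCast, ← ENNReal.rpow_mul]
        norm_num
    _ ≤ ∫⁻ ω, f ω ^ 2 ∂ρ := by
        gcongr with ω
        exact hgf ω

/-- The mean absolute deviation of `g` from its mean, under the probability measure `ρ`. -/
noncomputable def meanDeviation (ρ : Measure Ω) (g : Ω → ℝ) : ℝ≥0∞ :=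
  ∫⁻ ω, ‖g ω - ∫ ω', g ω' ∂ρ‖ₑ ∂ρ

theorem sq_meanDeviation_le_evariance (ρ : Measure Ω) [IsProbabilityMeasure ρ] (g : Ω → ℝ) :
    meanDeviation ρ g ^ 2 ≤ evariance g ρ :=
  sq_lintegral_le_lintegral_sq ρ _

end MeanDeviation

section TransitionOperator

variable {E : Type*} [PseudoMetricSpace E]

theorem dContinuous_dist_iff {f : E → ℝ} : DContinuous dist f ↔ Continuous f := by
  simp only [DContinuous, Metric.continuous_iff, Real.dist_eq, dist_comm (α := E)]

variable [MeasurableSpace E]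

theorem memLp_boundedContinuous [OpensMeasurableSpace E] (ρ : Measure E) [IsFiniteMeasure ρ]
    (f : E →ᵇ ℝ) (p : ℝ≥0∞) : MemLp f p ρ :=
  .of_bound f.continuous.measurable.aestronglyMeasurable ‖f‖ (.of_forall f.norm_coe_le_norm)

variable {P : Kernel E E} [IsMarkovKernel P]

/-- The transition operator `f ↦ ∫ f(y) P(·, dy)` of a Feller chain, acting on the bounded
continuous functions. -/
noncomputable def IsDFeller.transitionOp (hP : IsDFeller dist P) (f : E →ᵇ ℝ) : E →ᵇ ℝ :=
  .ofNormedAddCommGroup (fun x => ∫ y, f y ∂P x)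
    (dContinuous_dist_iff.1 (hP f ⟨‖f‖, f.norm_coe_le_norm⟩ (dContinuous_dist_iff.2 f.continuous)))
    ‖f‖ fun x => (norm_integral_le_of_norm_le_const (.of_forall f.norm_coe_le_norm)).trans_eq
      (by simp)

variable [OpensMeasurableSpace E] (hP : IsDFeller dist P)

theorem IsDFeller.iterate_transitionOp_apply (n : ℕ) (f : E →ᵇ ℝ) (x : E) :
    hP.transitionOp^[n] f x = ∫ y, f y ∂nStep P n x := by
  induction n generalizing f with
  | zero => exact (integral_dirac' f x f.continuous.measurable.stronglyMeasurable).symm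
  | succ n ih =>
    change _ = ∫ y, f y ∂(P ∘ₖ nStep P n) x
    rw [Function.iterate_succ_apply, ih, Kernel.integral_comp (f.integrable _)]
    rfl

theorem IsDFeller.norm_iterate_transitionOp_le (n : ℕ) (f : E →ᵇ ℝ) :
    ‖hP.transitionOp^[n] f‖ ≤ ‖f‖ := by
  refine (BoundedContinuousFunction.norm_le (norm_nonneg f)).2 fun x => ?_
  rw [hP.iterate_transitionOp_apply]
  exact (norm_integral_le_of_norm_le_const (.of_forall f.norm_coe_le_norm)).trans_eq (by simp)

theorem IsDFeller.variance_nStep (n : ℕ) (f : E →ᵇ ℝ) (x : E) :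
    Var[f; nStep P n x] = hP.transitionOp^[n] (f ^ 2) x - (hP.transitionOp^[n] f x) ^ 2 := by
  rw [variance_eq_sub (memLp_boundedContinuous _ f 2), hP.iterate_transitionOp_apply,
    hP.iterate_transitionOp_apply]
  rfl

variable {μ : Measure E}

theorem IsDFeller.integral_iterate_transitionOp [IsFiniteMeasure μ] (hμ : P.Invariant μ) (n : ℕ)
    (f : E →ᵇ ℝ) : ∫ x, hP.transitionOp^[n] f x ∂μ = ∫ x, f x ∂μ := by
  have h : (nStep P n ∘ₖ Kernel.const Unit μ) () = μ := by
    rw [← Measure.comp_eq_comp_const_apply]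
    exact invariant_nStep hμ n
  have key := Kernel.integral_comp (f.integrable ((nStep P n ∘ₖ Kernel.const Unit μ) ()))
  simpa only [hP.iterate_transitionOp_apply, h, Kernel.const_apply] using key.symm

theorem IsDFeller.integral_variance_nStep [IsFiniteMeasure μ] (hμ : P.Invariant μ) (n : ℕ)
    (f : E →ᵇ ℝ) : ∫ x, Var[f; nStep P n x] ∂μ =
      ∫ x, f x ^ 2 ∂μ - ∫ x, (hP.transitionOp^[n] f x) ^ 2 ∂μ := by
  simp only [hP.variance_nStep]
  refine (integral_sub (BoundedContinuousFunction.integrable μ (hP.transitionOp^[n] (f ^ 2)))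
    (BoundedContinuousFunction.integrable μ ((hP.transitionOp^[n] f) ^ 2))).trans ?_
  rw [hP.integral_iterate_transitionOp hμ]
  rfl

theorem IsDFeller.lintegral_evariance_nStep [IsFiniteMeasure μ] (hμ : P.Invariant μ) (n : ℕ)
    (f : E →ᵇ ℝ) : ∫⁻ x, eVar[f; nStep P n x] ∂μ =
      ENNReal.ofReal (∫ x, f x ^ 2 ∂μ - ∫ x, (hP.transitionOp^[n] f x) ^ 2 ∂μ) := by
  have h_int : Integrable (fun x => Var[f; nStep P n x]) μ := by
    simp only [hP.variance_nStep]
    exact BoundedContinuousFunction.integrable μ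
      (hP.transitionOp^[n] (f ^ 2) - (hP.transitionOp^[n] f) ^ 2)
  rw [← hP.integral_variance_nStep hμ,
    ofReal_integral_eq_lintegral_ofReal h_int (.of_forall fun _ => variance_nonneg _ _)]
  exact lintegral_congr fun x => (ofReal_variance (memLp_boundedContinuous _ f 2)).symm

theorem IsDFeller.sq_lintegral_meanDeviation_le [IsProbabilityMeasure μ] (hμ : P.Invariant μ)
    (n : ℕ) (f : E →ᵇ ℝ) : (∫⁻ x, meanDeviation (nStep P n x) f ∂μ) ^ 2 ≤
      ENNReal.ofReal (∫ x, f x ^ 2 ∂μ - ∫ x, (hP.transitionOp^[n] f x) ^ 2 ∂μ) := by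
  rw [← hP.lintegral_evariance_nStep hμ]
  exact (sq_lintegral_le_lintegral_sq μ _).trans
    (lintegral_mono fun x => sq_meanDeviation_le_evariance _ _)

theorem IsDFeller.tendsto_iSup_lintegral_meanDeviation [IsProbabilityMeasure μ]
    (hμ : P.Invariant μ) (f : E →ᵇ ℝ) :
    Tendsto (fun m => ⨆ n, ∫⁻ x, meanDeviation (nStep P n x) (hP.transitionOp^[m] f) ∂μ) atTop
      (𝓝 0) := by
  set v : ℕ → ℝ := fun m => ∫ x, (hP.transitionOp^[m] f x) ^ 2 ∂μ
  have v_loss (m n : ℕ) : ∫ x, Var[hP.transitionOp^[m] f; nStep P n x] ∂μ = v m - v (n + m) := by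
    rw [hP.integral_variance_nStep hμ, ← Function.iterate_add_apply]
  have v_anti : Antitone v := antitone_nat_of_succ_le fun m => by
    have := v_loss m 1 ▸ integral_nonneg fun x => variance_nonneg _ _
    rw [add_comm]
    linarith
  have v_bdd : BddBelow (Set.range v) :=
    ⟨0, Set.forall_mem_range.2 fun m => integral_nonneg fun x => sq_nonneg _⟩
  have hr : Tendsto (fun m => ENNReal.ofReal (v m - ⨅ k, v k) ^ (1 / 2 : ℝ)) atTop (𝓝 0) := by
    have := (tendsto_atTop_ciInf v_anti v_bdd).sub_const (⨅ k, v k)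
    rw [sub_self] at this
    simpa using (ENNReal.tendsto_ofReal this).ennrpow_const (1 / 2 : ℝ)
  refine tendsto_of_tendsto_of_tendsto_of_le_of_le tendsto_const_nhds hr (fun _ => zero_le) ?_
  refine fun m => iSup_le fun n => ?_
  rw [one_div, ENNReal.le_rpow_inv_iff two_pos, ENNReal.rpow_two]
  refine (hP.sq_lintegral_meanDeviation_le hμ n _).trans (ENNReal.ofReal_le_ofReal ?_)
  rw [← Function.iterate_add_apply]
  exact sub_le_sub_left (ciInf_le v_bdd _) _

end TransitionOperator

section Oscillation

variable {E : Type*} [PseudoMetricSpace E]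

/-- The oscillation `sup {|g u - g v| : d(u, v) < r}` of `g` around `u` at scale `r`. -/
noncomputable def localOscillation (g : E → ℝ) (r : ℝ) (u : E) : ℝ≥0∞ :=
  ⨆ v ∈ Metric.ball u r, ‖g u - g v‖ₑ

theorem measurable_localOscillation [MeasurableSpace E] [OpensMeasurableSpace E] {g : E → ℝ}
    (hg : Continuous g) (r : ℝ) : Measurable (localOscillation g r) := by
  refine measurable_of_Ioi fun c => IsOpen.measurableSet ?_
  have h : localOscillation g r ⁻¹' Set.Ioi c =
      ⋃ v, {u | dist v u < r} ∩ {u | c < ‖g u - g v‖ₑ} := by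
    ext u
    simp [localOscillation, lt_iSup_iff]
  rw [h]
  exact isOpen_iUnion fun v => (isOpen_lt (by fun_prop) continuous_const).inter
    (isOpen_lt continuous_const (by fun_prop))

theorem tendsto_localOscillation {g : E → ℝ} {u : E} (hg : ContinuousAt g u) :
    Tendsto (fun k : ℕ => localOscillation g (1 / (k + 1)) u) atTop (𝓝 0) := by
  refine ENNReal.tendsto_nhds_zero.2 fun c hc => ?_
  have hg' : ∀ᶠ v in 𝓝 u, edist (g v) (g u) < c := hg (Metric.eball_mem_nhds (g u) hc)
  obtain ⟨δ, hδ, h⟩ := Metric.eventually_nhds_iff_ball.1 hg'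
  filter_upwards [(tendsto_one_div_add_atTop_nhds_zero_nat (𝕜 := ℝ)).eventually_lt_const hδ]
    with k hk
  refine iSup₂_le fun v hv => ?_
  rw [← edist_eq_enorm_sub, edist_comm]
  exact (h v (Metric.ball_subset_ball hk.le hv)).le

theorem localOscillation_le (g : E →ᵇ ℝ) (r : ℝ) (u : E) :
    localOscillation g r u ≤ ENNReal.ofReal (2 * ‖g‖) := by
  refine iSup₂_le fun v _ => ?_
  rw [← ofReal_norm, ← dist_eq_norm]
  exact ENNReal.ofReal_le_ofReal (g.dist_le_two_norm u v)

theorem tendsto_lintegral_localOscillation [MeasurableSpace E] [OpensMeasurableSpace E]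
    (μ : Measure E) [IsFiniteMeasure μ] (g : E →ᵇ ℝ) :
    Tendsto (fun k : ℕ => ∫⁻ u, localOscillation g (1 / (k + 1)) u ∂μ) atTop (𝓝 0) := by
  rw [← lintegral_zero (μ := μ)]
  refine tendsto_lintegral_of_dominated_convergence (fun _ => ENNReal.ofReal (2 * ‖g‖))
    (fun k => measurable_localOscillation g.continuous _)
    (fun k => .of_forall (localOscillation_le g _)) ?_
    (.of_forall fun u => tendsto_localOscillation g.continuous.continuousAt)
  rw [lintegral_const]
  exact ENNReal.mul_ne_top ENNReal.ofReal_ne_top (measure_ne_top μ _)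

variable [MeasurableSpace E] [OpensMeasurableSpace E]

theorem measure_dist_le_mul_enorm_le {κ₁ κ₂ : Measure E} {ξ : Measure (E × E)}
    (hξ : ξ ∈ couplings κ₁ κ₂) {g : E → ℝ} (hg : Continuous g) {ε r : ℝ} (hε : ε < r) :
    ξ {z | dist z.1 z.2 ≤ ε} * ‖∫ u, g u ∂κ₁ - ∫ u, g u ∂κ₂‖ₑ ≤
      meanDeviation κ₁ g + ∫⁻ u, localOscillation g r u ∂κ₁ + meanDeviation κ₂ g := by
  obtain ⟨-, rfl, rfl⟩ := hξ
  set c₁ := ∫ u, g u ∂ξ.fst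
  set c₂ := ∫ u, g u ∂ξ.snd
  have hosc := measurable_localOscillation hg r
  have hgm := hg.measurable
  have hdev (c : ℝ) : Measurable fun u => ‖g u - c‖ₑ := by fun_prop
  have triangle : ∀ z ∈ {z : E × E | dist z.1 z.2 ≤ ε},
      ‖c₁ - c₂‖ₑ ≤ (‖g z.1 - c₁‖ₑ + localOscillation g r z.1) + ‖g z.2 - c₂‖ₑ := by
    intro z hz
    have hosc_ge : ‖g z.1 - g z.2‖ₑ ≤ localOscillation g r z.1 :=
      le_biSup (fun v => ‖g z.1 - g v‖ₑ)
        (Metric.mem_ball'.2 (lt_of_le_of_lt hz hε))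
    calc ‖c₁ - c₂‖ₑ = ‖-(g z.1 - c₁) + (g z.1 - g z.2) + (g z.2 - c₂)‖ₑ := by ring_nf
      _ ≤ ‖-(g z.1 - c₁)‖ₑ + ‖g z.1 - g z.2‖ₑ + ‖g z.2 - c₂‖ₑ :=
        (enorm_add_le _ _).trans (by gcongr; exact enorm_add_le _ _)
      _ ≤ _ := by rw [enorm_neg]; gcongr
  have lintegral_fst_snd : ∫⁻ z, (‖g z.1 - c₁‖ₑ + localOscillation g r z.1) + ‖g z.2 - c₂‖ₑ ∂ξ =
      ∫⁻ u, ‖g u - c₁‖ₑ ∂ξ.fst + ∫⁻ u, localOscillation g r u ∂ξ.fst +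
        ∫⁻ u, ‖g u - c₂‖ₑ ∂ξ.snd := by
    rw [lintegral_add_left (by fun_prop), lintegral_add_left (by fun_prop),
      ← lintegral_map (hdev c₁) measurable_fst, ← lintegral_map hosc measurable_fst,
      ← lintegral_map (hdev c₂) measurable_snd]
    rfl
  calc ξ {z | dist z.1 z.2 ≤ ε} * ‖c₁ - c₂‖ₑ
      = ∫⁻ _ in {z | dist z.1 z.2 ≤ ε}, ‖c₁ - c₂‖ₑ ∂ξ := by rw [setLIntegral_const, mul_comm]
    _ ≤ ∫⁻ z, (‖g z.1 - c₁‖ₑ + localOscillation g r z.1) + ‖g z.2 - c₂‖ₑ ∂ξ :=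
        (setLIntegral_mono (by fun_prop) triangle).trans (setLIntegral_le_lintegral _ _)
    _ = _ := lintegral_fst_snd

end Oscillation

section Limits

variable {Ω : Type*} [MeasurableSpace Ω]

theorem limsup_lintegral_le_lintegral_limsup_tsub_add {ρ : Measure Ω} [IsFiniteMeasure ρ]
    {D R : ℕ → Ω → ℝ≥0∞} {B c : ℝ≥0∞} (hB : B ≠ ∞) (hDm : ∀ n, Measurable (D n))
    (hD : ∀ n ω, D n ω ≤ B) (hRm : ∀ n, Measurable (R n)) (hR : ∀ n, ∫⁻ ω, R n ω ∂ρ ≤ c) :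
    limsup (fun n => ∫⁻ ω, D n ω ∂ρ) atTop ≤
      ∫⁻ ω, limsup (fun n => D n ω - R n ω) atTop ∂ρ + c := by
  have hFm (n : ℕ) : Measurable fun ω => D n ω - R n ω := (hDm n).sub (hRm n)
  calc limsup (fun n => ∫⁻ ω, D n ω ∂ρ) atTop
      ≤ limsup (fun n => ∫⁻ ω, D n ω - R n ω ∂ρ + c) atTop := by
        refine limsup_le_limsup (.of_forall fun n => ?_)
        calc ∫⁻ ω, D n ω ∂ρ ≤ ∫⁻ ω, D n ω - R n ω + R n ω ∂ρ :=
              lintegral_mono fun ω => le_tsub_add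
          _ ≤ ∫⁻ ω, D n ω - R n ω ∂ρ + c := by
              rw [lintegral_add_left (hFm n)]
              gcongr
              exact hR n
    _ = limsup (fun n => ∫⁻ ω, D n ω - R n ω ∂ρ) atTop + c :=
        limsup_add_const _ _ _ (by isBoundedDefault) (by isBoundedDefault)
    _ ≤ ∫⁻ ω, limsup (fun n => D n ω - R n ω) atTop ∂ρ + c := by
        gcongr
        refine limsup_lintegral_le (fun _ => B) hFm
          (fun n => .of_forall fun ω => tsub_le_self.trans (hD n ω)) ?_
        rw [lintegral_const]
        exact ENNReal.mul_ne_top hB (measure_ne_top ρ _)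

theorem tendsto_lintegral_zero_of_eventually_mul_le {ρ : Measure Ω} [IsFiniteMeasure ρ]
    {D : ℕ → Ω → ℝ≥0∞} {R : ℕ → ℕ → Ω → ℝ≥0∞} {r : ℕ → ℝ≥0∞} {B : ℝ≥0∞} (hB : B ≠ ∞)
    (hDm : ∀ n, Measurable (D n)) (hD : ∀ n ω, D n ω ≤ B) (hRm : ∀ m n, Measurable (R m n))
    (hR : ∀ m n, ∫⁻ ω, R m n ω ∂ρ ≤ r m) (hr : Tendsto r atTop (𝓝 0))
    (h : ∀ᵐ ω ∂ρ, ∃ a ≠ 0, ∀ m, ∀ᶠ n in atTop, a * D (n + m) ω ≤ R m n ω) :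
    Tendsto (fun n => ∫⁻ ω, D n ω ∂ρ) atTop (𝓝 0) := by
  -- The constant `a` depends on `ω`; it is replaced by `1 / j`, and `j → ∞` only after `m → ∞`.
  set S : ℕ → Ω → ℝ≥0∞ := fun j ω => ⨆ m, limsup (fun n => D (n + m) ω - j * R m n ω) atTop
  have hSB (j : ℕ) (ω : Ω) : S j ω ≤ B := iSup_le fun m => limsup_le_of_le (by isBoundedDefault)
    (.of_forall fun n => tsub_le_self.trans (hD _ ω))
  have hS_zero : ∀ᵐ ω ∂ρ, ∀ᶠ j in atTop, S j ω = 0 := by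
    filter_upwards [h] with ω ⟨a, ha, hω⟩
    obtain ⟨k, hk⟩ := ENNReal.exists_nat_mul_gt ha ENNReal.one_ne_top
    filter_upwards [eventually_ge_atTop k] with j hj
    refine iSup_eq_bot.2 fun m => (limsup_congr ?_).trans limsup_const_bot
    refine (hω m).mono fun n hn => tsub_eq_zero_of_le ?_
    calc D (n + m) ω ≤ (k * a) * D (n + m) ω := le_mul_of_one_le_left' hk.le
      _ ≤ j * R m n ω := by rw [mul_assoc]; gcongr
  have hS_lim : Tendsto (fun j => ∫⁻ ω, S j ω ∂ρ) atTop (𝓝 0) := by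
    rw [← lintegral_zero (μ := ρ)]
    refine tendsto_lintegral_of_dominated_convergence (fun _ => B)
      (fun j => .iSup fun m => .limsup fun n => (hDm _).sub ((hRm m n).const_mul _))
      (fun j => .of_forall (hSB j)) ?_
      (hS_zero.mono fun ω hω => tendsto_const_nhds.congr' (hω.mono fun j hj => hj.symm))
    rw [lintegral_const]
    exact ENNReal.mul_ne_top hB (measure_ne_top ρ _)
  have hbound (j m : ℕ) : limsup (fun n => ∫⁻ ω, D n ω ∂ρ) atTop ≤ ∫⁻ ω, S j ω ∂ρ + j * r m := by
    rw [← limsup_nat_add _ m]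
    refine (limsup_lintegral_le_lintegral_limsup_tsub_add hB (fun n => hDm (n + m))
      (fun n => hD (n + m)) (fun n => (hRm m n).const_mul (j : ℝ≥0∞)) (c := j * r m)
      fun n => ?_).trans ?_
    · rw [lintegral_const_mul _ (hRm m n)]
      gcongr
      exact hR m n
    · gcongr with ω
      exact le_iSup (fun m => limsup (fun n => D (n + m) ω - j * R m n ω) atTop) m
  have hlim (j : ℕ) : limsup (fun n => ∫⁻ ω, D n ω ∂ρ) atTop ≤ ∫⁻ ω, S j ω ∂ρ := by
    have := tendsto_const_nhds (x := ∫⁻ ω, S j ω ∂ρ).add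
      (ENNReal.Tendsto.const_mul hr (.inr (ENNReal.natCast_ne_top j)))
    rw [mul_zero, add_zero] at this
    exact ge_of_tendsto' this (hbound j)
  exact tendsto_of_le_liminf_of_limsup_le zero_le (ge_of_tendsto' hS_lim hlim)

end Limits

section Kernels

variable {Ω : Type*} [MeasurableSpace Ω]

theorem measurable_meanDeviation (κ : Kernel Ω Ω) [IsSFiniteKernel κ] {g : Ω → ℝ}
    (hg : Measurable g) :
    Measurable fun x => meanDeviation (κ x) g := by
  have hmean : Measurable fun x => ∫ y, g y ∂κ x :=
    (hg.stronglyMeasurable.integral_kernel (κ := κ)).measurable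
  exact ((hg.comp measurable_snd).sub
    (hmean.comp measurable_fst)).enorm.lintegral_kernel_prod_right'

theorem lintegral_lintegral_of_invariant {κ : Kernel Ω Ω} {μ : Measure Ω} (h : κ.Invariant μ)
    {φ : Ω → ℝ≥0∞} (hφ : Measurable φ) : ∫⁻ x, ∫⁻ y, φ y ∂κ x ∂μ = ∫⁻ x, φ x ∂μ := by
  rw [← Measure.lintegral_bind κ.aemeasurable hφ.aemeasurable, h.def]

end Kernels

section Ergodicity

variable {E : Type*} [PseudoMetricSpace E] [MeasurableSpace E] [OpensMeasurableSpace E]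
  {P : Kernel E E} [IsMarkovKernel P]

/-- Bounds `a |∫ g dP_n(x, ·) - ∫ g dP_n(y, ·)|` when some coupling of `P_n(x, ·)` and
`P_n(y, ·)` gives mass at least `a` to pairs of points at distance less than `r`; here
`z = (x, y)`. -/
noncomputable def pairError (P : Kernel E E) (n : ℕ) (g : E → ℝ) (r : ℝ) (z : E × E) : ℝ≥0∞ :=
  meanDeviation (nStep P n z.1) g + ∫⁻ u, localOscillation g r u ∂nStep P n z.1 +
    meanDeviation (nStep P n z.2) g

theorem CouplingCond.exists_eventually_mul_enorm_le {x y : E} (h : CouplingCond dist P x y) :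
    ∃ a ≠ 0, ∀ g : E → ℝ, Continuous g → ∀ r > 0, ∀ᶠ n in atTop,
      a * ‖∫ u, g u ∂nStep P n x - ∫ u, g u ∂nStep P n y‖ₑ ≤ pairError P n g r (x, y) := by
  obtain ⟨a, ha, -, h⟩ := limZero_iSup_pos_iff.1 h
  refine ⟨a, ha, fun g hg r hr => (h (r / 2) (half_pos hr)).mono fun n hn => ?_⟩
  refine (mul_le_mul_left (hn.trans (iSup_closeAt_le dist x y n _)) _).trans ?_
  simp only [ENNReal.iSup_mul]
  exact iSup₂_le fun ξ hξ => measure_dist_le_mul_enorm_le hξ hg (half_lt_self hr)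

theorem measurable_pairError (n : ℕ) {g : E → ℝ} (hg : Continuous g) (r : ℝ) :
    Measurable (pairError P n g r) := by
  have hdev := measurable_meanDeviation (nStep P n) hg.measurable
  have hosc := (measurable_localOscillation hg r).lintegral_kernel (κ := nStep P n)
  exact ((hdev.comp measurable_fst).add (hosc.comp measurable_fst)).add (hdev.comp measurable_snd)

variable {μ : Measure E} [IsProbabilityMeasure μ]

theorem lintegral_pairError (hμ : P.Invariant μ) (n : ℕ) {g : E → ℝ} (hg : Continuous g)
    (r : ℝ) : ∫⁻ z, pairError P n g r z ∂μ.prod μ =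
      ∫⁻ x, meanDeviation (nStep P n x) g ∂μ + ∫⁻ u, localOscillation g r u ∂μ +
        ∫⁻ x, meanDeviation (nStep P n x) g ∂μ := by
  have hdev := measurable_meanDeviation (nStep P n) hg.measurable
  have hosc := (measurable_localOscillation hg r).lintegral_kernel (κ := nStep P n)
  have lintegral_prod_add {φ ψ : E → ℝ≥0∞} (hφ : Measurable φ) (hψ : Measurable ψ) :
      ∫⁻ z, φ z.1 + ψ z.1 + φ z.2 ∂μ.prod μ = ∫⁻ x, φ x ∂μ + ∫⁻ x, ψ x ∂μ + ∫⁻ x, φ x ∂μ := by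
    rw [lintegral_add_left (by fun_prop), lintegral_add_left (by fun_prop),
      measurePreserving_fst.lintegral_comp hφ, measurePreserving_fst.lintegral_comp hψ,
      measurePreserving_snd.lintegral_comp hφ]
  rw [← lintegral_lintegral_of_invariant (invariant_nStep hμ n) (measurable_localOscillation hg r)]
  exact lintegral_prod_add hdev hosc

theorem IsDFeller.enorm_iterate_transitionOp_sub_le (hP : IsDFeller dist P) (n : ℕ)
    (f : E →ᵇ ℝ) (x y : E) :
    ‖hP.transitionOp^[n] f x - hP.transitionOp^[n] f y‖ₑ ≤ ENNReal.ofReal (2 * ‖f‖) := by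
  rw [← ofReal_norm, ← dist_eq_norm]
  refine ENNReal.ofReal_le_ofReal ((BoundedContinuousFunction.dist_le_two_norm _ x y).trans ?_)
  gcongr
  exact hP.norm_iterate_transitionOp_le n f

theorem IsDFeller.tendsto_lintegral_enorm_sub (hP : IsDFeller dist P) (hμ : P.Invariant μ)
    (h : ∀ᵐ z ∂μ.prod μ, CouplingCond dist P z.1 z.2) (f : E →ᵇ ℝ) :
    Tendsto (fun n => ∫⁻ z, ‖hP.transitionOp^[n] f z.1 - hP.transitionOp^[n] f z.2‖ₑ ∂μ.prod μ)
      atTop (𝓝 0) := by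
  set g : ℕ → E →ᵇ ℝ := fun m => hP.transitionOp^[m] f
  have hgm (m : ℕ) : Measurable (g m) := (g m).continuous.measurable
  have scale (m : ℕ) : ∃ k : ℕ,
      ∫⁻ u, localOscillation (g m) (1 / (k + 1)) u ∂μ ≤ ((m : ℝ≥0∞) + 1)⁻¹ :=
    ((tendsto_lintegral_localOscillation μ (g m)).eventually_le_const (by simp)).exists
  choose k hk using scale
  set S : ℕ → ℝ≥0∞ := fun m => ⨆ n, ∫⁻ x, meanDeviation (nStep P n x) (g m) ∂μ
  have lintegral_error_le (m n : ℕ) : ∫⁻ z, pairError P n (g m) (1 / (k m + 1)) z ∂μ.prod μ ≤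
      S m + ((m : ℝ≥0∞) + 1)⁻¹ + S m := by
    rw [lintegral_pairError hμ n (g m).continuous]
    have hS := le_iSup (fun n => ∫⁻ x, meanDeviation (nStep P n x) (g m) ∂μ) n
    gcongr
    exact hk m
  have tendsto_error : Tendsto (fun m => S m + ((m : ℝ≥0∞) + 1)⁻¹ + S m) atTop (𝓝 0) := by
    have hS := hP.tendsto_iSup_lintegral_meanDeviation hμ f
    have hinv : Tendsto (fun m : ℕ => ((m : ℝ≥0∞) + 1)⁻¹) atTop (𝓝 0) := by
      exact_mod_cast (tendsto_add_atTop_iff_nat 1).2 ENNReal.tendsto_inv_nat_nhds_zero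
    simpa only [add_zero] using (hS.add hinv).add hS
  have contraction : ∀ᵐ z ∂μ.prod μ, ∃ a ≠ 0, ∀ m, ∀ᶠ n in atTop,
      a * ‖g (n + m) z.1 - g (n + m) z.2‖ₑ ≤ pairError P n (g m) (1 / (k m + 1)) z := by
    filter_upwards [h] with z hz
    obtain ⟨a, ha, ha'⟩ := hz.exists_eventually_mul_enorm_le
    refine ⟨a, ha, fun m => (ha' (g m) (g m).continuous (1 / (k m + 1)) (by positivity)).mono ?_⟩
    intro n hn
    simp only [g, Function.iterate_add_apply]
    rwa [hP.iterate_transitionOp_apply, hP.iterate_transitionOp_apply]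
  exact tendsto_lintegral_zero_of_eventually_mul_le ENNReal.ofReal_ne_top
    (fun n => (((hgm n).comp measurable_fst).sub ((hgm n).comp measurable_snd)).enorm)
    (fun n z => hP.enorm_iterate_transitionOp_sub_le n f z.1 z.2)
    (fun m n => measurable_pairError n (g m).continuous _) lintegral_error_le tendsto_error
    contraction

theorem IsDFeller.tendsto_lintegral_enorm_sub_integral (hP : IsDFeller dist P)
    (hμ : P.Invariant μ) (h : ∀ᵐ z ∂μ.prod μ, CouplingCond dist P z.1 z.2) (f : E →ᵇ ℝ) :
    Tendsto (fun n => ∫⁻ x, ‖∫ y, f y ∂nStep P n x - ∫ y, f y ∂μ‖ₑ ∂μ) atTop (𝓝 0) := by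
  refine tendsto_of_tendsto_of_tendsto_of_le_of_le tendsto_const_nhds
    (hP.tendsto_lintegral_enorm_sub hμ h f) (fun _ => zero_le) fun n => ?_
  set g := hP.transitionOp^[n] f
  have hgm : Measurable g := g.continuous.measurable
  have hg_sub : Measurable fun z : E × E => ‖g z.1 - g z.2‖ₑ := by fun_prop
  calc ∫⁻ x, ‖∫ y, f y ∂nStep P n x - ∫ y, f y ∂μ‖ₑ ∂μ = ∫⁻ x, ‖∫ y, (g x - g y) ∂μ‖ₑ ∂μ := by
        refine lintegral_congr fun x => ?_
        rw [integral_sub (integrable_const _) (g.integrable μ), integral_const, probReal_univ,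
          one_smul, hP.integral_iterate_transitionOp hμ, hP.iterate_transitionOp_apply]
    _ ≤ ∫⁻ x, ∫⁻ y, ‖g x - g y‖ₑ ∂μ ∂μ :=
        lintegral_mono fun x => enorm_integral_le_lintegral_enorm _
    _ = ∫⁻ z, ‖g z.1 - g z.2‖ₑ ∂μ.prod μ := (lintegral_prod _ hg_sub.aemeasurable).symm

end Ergodicity

section PartitionOfUnity

variable {E : Type*} [PseudoMetricSpace E]

theorem exists_bump (c : E) {r : ℝ} (hr : 0 < r) :
    ∃ b : E →ᵇ ℝ, (∀ x, b x ∈ Set.Icc (0 : ℝ) 1) ∧ (∀ x, dist x c < r / 4 → b x = 1) ∧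
      ∀ x, b x ≠ 0 → dist x c < r / 2 := by
  obtain ⟨b, hb0, hb1, hb⟩ := exists_bounded_zero_one_of_closed
    (Metric.isOpen_ball (x := c) (ε := r / 2)).isClosed_compl
    (Metric.isClosed_closedBall (x := c) (ε := r / 4))
    (Set.disjoint_compl_left_iff_subset.2 (Metric.closedBall_subset_ball (by linarith)))
  exact ⟨b, hb, fun x hx => hb1 hx.le, fun x hx => by_contra fun h => hx (hb0 h)⟩

theorem exists_partition_of_unity [Nonempty E] [TopologicalSpace.SeparableSpace E] {r : ℝ}
    (hr : 0 < r) : ∃ φ : ℕ → E →ᵇ ℝ, (∀ k x, 0 ≤ φ k x) ∧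
      (∀ k x y, φ k x ≠ 0 → φ k y ≠ 0 → dist x y ≤ r) ∧ ∀ x, HasSum (fun k => φ k x) 1 := by
  choose b hb hb_one hb_supp using fun k => exists_bump (TopologicalSpace.denseSeq E k) hr
  set p : ℕ → E → ℝ := fun n x => ∏ j ∈ Finset.range n, (1 - b j x)
  set φ : ℕ → E →ᵇ ℝ := fun k => (∏ j ∈ Finset.range k, (1 - b j)) * b k
  have hφ (k : ℕ) (x : E) : φ k x = p k x * b k x := by simp [φ, p]
  have φ_nonneg (k : ℕ) (x : E) : 0 ≤ φ k x := by
    rw [hφ]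
    exact mul_nonneg (Finset.prod_nonneg fun j _ => sub_nonneg.2 (hb j x).2) (hb k x).1
  have φ_supp {k : ℕ} {x : E} (h : φ k x ≠ 0) : dist x (TopologicalSpace.denseSeq E k) < r / 2 :=
    hb_supp k x (right_ne_zero_of_mul (hφ k x ▸ h))
  refine ⟨φ, φ_nonneg, fun k x y hx hy => ?_, fun x => ?_⟩
  · linarith [dist_triangle_right x y (TopologicalSpace.denseSeq E k), φ_supp hx, φ_supp hy]
  have sum_φ (n : ℕ) : ∑ k ∈ Finset.range n, φ k x = 1 - p n x := by
    rw [← Finset.prod_range_zero fun j => 1 - b j x, ← Finset.sum_range_sub' (fun n => p n x)]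
    refine Finset.sum_congr rfl fun k _ => ?_
    simp only [hφ, p, Finset.prod_range_succ]
    ring
  obtain ⟨m, hm⟩ :=
    (TopologicalSpace.denseRange_denseSeq E).exists_dist_lt x (by positivity : 0 < r / 4)
  rw [hasSum_iff_tendsto_nat_of_nonneg fun k => φ_nonneg k x]
  refine tendsto_const_nhds.congr' ?_
  filter_upwards [eventually_gt_atTop m] with n hn
  have p_eq_zero : p n x = 0 :=
    Finset.prod_eq_zero (Finset.mem_range.2 hn) (by rw [hb_one m x hm, sub_self])
  rw [sum_φ, p_eq_zero, sub_zero]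

end PartitionOfUnity

section MinimalDist

variable {S : Type*} [MeasurableSpace S]

theorem measure_sum_mono {ι : Type*} {m m' : ι → Measure S} (h : ∀ i, m i ≤ m' i) :
    Measure.sum m ≤ Measure.sum m' := Measure.le_iff.2 fun s hs => by
  simp only [Measure.sum_apply _ hs]
  exact ENNReal.tsum_le_tsum fun i => h i s

variable {κ μ : Measure S} [IsProbabilityMeasure κ] [IsProbabilityMeasure μ] {d : S → S → ℝ}
  {r C : ℝ}

theorem minimalDist_le_of_subcoupling (hd : ∀ x y, d x y ≤ C) {ζ : Measure (S × S)}
    (h₁ : ζ.fst ≤ κ) (h₂ : ζ.snd ≤ μ) (hζ : ∀ᵐ z ∂ζ, d z.1 z.2 ≤ r) :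
    minimalDist d κ μ ≤ ENNReal.ofReal r + ENNReal.ofReal C * (1 - ζ .univ) := by
  obtain ⟨η, hη, hle⟩ := exists_coupling_ge h₁ h₂
  have := hη.1
  have := isFiniteMeasure_of_le η hle
  have hζ1 : ζ .univ ≤ 1 := (hle .univ).trans_eq measure_univ
  have near : ∫⁻ z, ENNReal.ofReal (d z.1 z.2) ∂ζ ≤ ENNReal.ofReal r :=
    calc ∫⁻ z, ENNReal.ofReal (d z.1 z.2) ∂ζ ≤ ∫⁻ _, ENNReal.ofReal r ∂ζ :=
          lintegral_mono_ae (hζ.mono fun z hz => ENNReal.ofReal_le_ofReal hz)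
      _ ≤ ENNReal.ofReal r := by
          rw [lintegral_const]
          exact mul_le_of_le_one_right' hζ1
  have far : ∫⁻ z, ENNReal.ofReal (d z.1 z.2) ∂(η - ζ) ≤ ENNReal.ofReal C * (1 - ζ .univ) :=
    calc ∫⁻ z, ENNReal.ofReal (d z.1 z.2) ∂(η - ζ) ≤ ∫⁻ _, ENNReal.ofReal C ∂(η - ζ) :=
          lintegral_mono fun z => ENNReal.ofReal_le_ofReal (hd z.1 z.2)
      _ = ENNReal.ofReal C * (1 - ζ .univ) := by
          rw [lintegral_const, Measure.sub_apply .univ hle, measure_univ]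
  calc minimalDist d κ μ ≤ ∫⁻ z, ENNReal.ofReal (d z.1 z.2) ∂η := iInf₂_le η hη
    _ = ∫⁻ z, ENNReal.ofReal (d z.1 z.2) ∂ζ + ∫⁻ z, ENNReal.ofReal (d z.1 z.2) ∂(η - ζ) := by
        rw [← lintegral_add_measure, add_comm, Measure.sub_add_cancel_of_le hle]
    _ ≤ _ := add_le_add near far

theorem minimalDist_le_tsum (hd : ∀ x y, d x y ≤ C) {w : ℕ → S → ℝ≥0∞}
    (hw : ∀ k, Measurable (w k)) (hw_sum : ∀ x, ∑' k, w k x = 1)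
    (hw_diam : ∀ k x y, w k x ≠ 0 → w k y ≠ 0 → d x y ≤ r) :
    minimalDist d κ μ ≤ ENNReal.ofReal r +
      ENNReal.ofReal C * ∑' k, (∫⁻ x, w k x ∂μ - ∫⁻ x, w k x ∂κ) := by
  have sum_withDensity (ρ : Measure S) : Measure.sum (fun k => ρ.withDensity (w k)) = ρ := by
    have hw_one : ∑' k, w k = 1 := funext fun x => (ENNReal.tsum_apply).trans (hw_sum x)
    rw [← withDensity_tsum hw, hw_one, withDensity_one]
  have sum_lintegral (ρ : Measure S) [IsProbabilityMeasure ρ] : ∑' k, ∫⁻ x, w k x ∂ρ = 1 := by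
    simp [← lintegral_tsum fun k => (hw k).aemeasurable, hw_sum]
  have finite (ρ : Measure S) [IsProbabilityMeasure ρ] (k : ℕ) :
      IsFiniteMeasure (ρ.withDensity (w k)) :=
    isFiniteMeasure_of_le ρ ((Measure.le_sum _ k).trans_eq (sum_withDensity ρ))
  choose ζ h₁ h₂ hζ using fun k => exists_marginals_le (κ.withDensity (w k)) (μ.withDensity (w k))
  have ae_ne_zero (ρ : Measure S) (k : ℕ) : ∀ᵐ x ∂ρ.withDensity (w k), w k x ≠ 0 :=
    (ae_withDensity_iff (hw k)).2 (.of_forall fun _ => id)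
  have close : ∀ᵐ z ∂Measure.sum ζ, d z.1 z.2 ≤ r := Measure.ae_sum_iff.2 fun k => by
    filter_upwards [ae_of_ae_map measurable_fst.aemeasurable (ae_mono (h₁ k) (ae_ne_zero κ k)),
      ae_of_ae_map measurable_snd.aemeasurable (ae_mono (h₂ k) (ae_ne_zero μ k))] with z hx hy
    exact hw_diam k _ _ hx hy
  have mass : 1 - Measure.sum ζ .univ ≤ ∑' k, (∫⁻ x, w k x ∂μ - ∫⁻ x, w k x ∂κ) := by
    rw [tsub_le_iff_right, Measure.sum_apply _ .univ, ← ENNReal.tsum_add, ← sum_lintegral μ]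
    refine ENNReal.tsum_le_tsum fun k => ?_
    rw [hζ, withDensity_apply _ .univ, withDensity_apply _ .univ, setLIntegral_univ,
      setLIntegral_univ, min_comm, tsub_add_min]
  refine (minimalDist_le_of_subcoupling hd (ζ := .sum ζ) ?_ ?_ close).trans (by gcongr)
  · rw [Measure.fst_sum]
    exact (measure_sum_mono h₁).trans_eq (sum_withDensity κ)
  · rw [Measure.snd_sum]
    exact (measure_sum_mono h₂).trans_eq (sum_withDensity μ)

end MinimalDist

section Convergence

variable {Ω E : Type*} [MeasurableSpace Ω] {ρ : Measure Ω} [IsFiniteMeasure ρ]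
  [PseudoMetricSpace E] [MeasurableSpace E] [OpensMeasurableSpace E]

theorem lintegral_ofReal_tsub_le_enorm_integral_sub (μ ν : Measure E) [IsFiniteMeasure μ]
    [IsFiniteMeasure ν] {φ : E →ᵇ ℝ} (hφ : ∀ x, 0 ≤ φ x) :
    ∫⁻ x, ENNReal.ofReal (φ x) ∂μ - ∫⁻ x, ENNReal.ofReal (φ x) ∂ν ≤
      ‖∫ x, φ x ∂ν - ∫ x, φ x ∂μ‖ₑ := by
  rw [← ofReal_integral_eq_lintegral_ofReal (φ.integrable μ) (.of_forall hφ),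
    ← ofReal_integral_eq_lintegral_ofReal (φ.integrable ν) (.of_forall hφ),
    ← ENNReal.ofReal_sub _ (integral_nonneg hφ), ← enorm_neg, neg_sub, ← ofReal_norm]
  exact ENNReal.ofReal_le_ofReal (Real.le_norm_self _)

variable {κ : ℕ → Kernel Ω E} [∀ n, IsMarkovKernel (κ n)] {μ : Measure E} [IsProbabilityMeasure μ]

theorem tendsto_lintegral_tsum_tsub
    (h : ∀ f : E →ᵇ ℝ,
      Tendsto (fun n => ∫⁻ ω, ‖∫ y, f y ∂κ n ω - ∫ y, f y ∂μ‖ₑ ∂ρ) atTop (𝓝 0))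
    {φ : ℕ → E →ᵇ ℝ} (hφ : ∀ k x, 0 ≤ φ k x) (hφ_sum : ∀ x, ∑' k, ENNReal.ofReal (φ k x) = 1) :
    Tendsto (fun n => ∫⁻ ω, ∑' k, (∫⁻ x, ENNReal.ofReal (φ k x) ∂μ -
      ∫⁻ x, ENNReal.ofReal (φ k x) ∂κ n ω) ∂ρ) atTop (𝓝 0) := by
  set w : ℕ → E → ℝ≥0∞ := fun k x => ENNReal.ofReal (φ k x)
  have hw (k : ℕ) : Measurable (w k) := (φ k).continuous.measurable.ennreal_ofReal
  set δ : ℕ → ℕ → ℝ≥0∞ := fun n k => ∫⁻ ω, (∫⁻ x, w k x ∂μ - ∫⁻ x, w k x ∂κ n ω) ∂ρ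
  have δ_le (n k : ℕ) : δ n k ≤ (∫⁻ x, w k x ∂μ) * ρ .univ :=
    (lintegral_mono fun ω => tsub_le_self).trans_eq (lintegral_const _)
  have δ_lim (k : ℕ) : Tendsto (fun n => δ n k) atTop (𝓝 0) :=
    tendsto_of_tendsto_of_tendsto_of_le_of_le tendsto_const_nhds (h (φ k)) (fun _ => zero_le)
      fun n => lintegral_mono fun ω => lintegral_ofReal_tsub_le_enorm_integral_sub _ _ (hφ k)
  have bound_sum : ∑' k, (∫⁻ x, w k x ∂μ) * ρ .univ ≠ ∞ := by
    rw [ENNReal.tsum_mul_right, ← lintegral_tsum fun k => (hw k).aemeasurable]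
    simp [w, hφ_sum]
  have hδ : Tendsto (fun n => ∫⁻ k, δ n k ∂Measure.count) atTop (𝓝 0) := by
    rw [← lintegral_zero (μ := (Measure.count : Measure ℕ))]
    refine tendsto_lintegral_of_dominated_convergence (fun k => (∫⁻ x, w k x ∂μ) * ρ .univ)
      (fun n => measurable_of_countable _) (fun n => .of_forall (δ_le n)) ?_ (.of_forall δ_lim)
    rwa [lintegral_count]
  refine hδ.congr fun n => ?_
  exact (lintegral_count _).trans (lintegral_tsum fun k =>
    (measurable_const.sub (hw k).lintegral_kernel).aemeasurable).symm

theorem tendsto_measure_minimalDist_gt [TopologicalSpace.SeparableSpace E] [BoundedSpace E]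
    (h : ∀ f : E →ᵇ ℝ,
      Tendsto (fun n => ∫⁻ ω, ‖∫ y, f y ∂κ n ω - ∫ y, f y ∂μ‖ₑ ∂ρ) atTop (𝓝 0))
    {ε : ℝ} (hε : 0 < ε) :
    Tendsto (fun n => ρ {ω | ENNReal.ofReal ε < minimalDist dist (κ n ω) μ}) atTop (𝓝 0) := by
  have := nonempty_of_isProbabilityMeasure μ
  obtain ⟨C, hC⟩ := Metric.boundedSpace_iff.1 ‹BoundedSpace E›
  obtain ⟨φ, hφ, hφ_diam, hφ_sum⟩ := exists_partition_of_unity (E := E) (half_pos hε)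
  set w : ℕ → E → ℝ≥0∞ := fun k x => ENNReal.ofReal (φ k x)
  have hw (k : ℕ) : Measurable (w k) := (φ k).continuous.measurable.ennreal_ofReal
  have hw_sum (x : E) : ∑' k, w k x = 1 := by
    rw [← ENNReal.ofReal_tsum_of_nonneg (fun k => hφ k x) (hφ_sum x).summable,
      (hφ_sum x).tsum_eq, ENNReal.ofReal_one]
  have hw_ne {k : ℕ} {x : E} (hx : w k x ≠ 0) : φ k x ≠ 0 := fun h => hx (by simp [w, h])
  set T : ℕ → Ω → ℝ≥0∞ := fun n ω => ∑' k, (∫⁻ x, w k x ∂μ - ∫⁻ x, w k x ∂κ n ω)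
  have hT (n : ℕ) : Measurable (T n) :=
    Measurable.tsum fun k => measurable_const.sub (hw k).lintegral_kernel
  have hC_top : ENNReal.ofReal C ≠ ∞ := ENNReal.ofReal_ne_top
  have hε_ne : ENNReal.ofReal (ε / 2) ≠ 0 := (ENNReal.ofReal_pos.2 (half_pos hε)).ne'
  have bound_lim : Tendsto (fun n => ENNReal.ofReal C * (∫⁻ ω, T n ω ∂ρ) / ENNReal.ofReal (ε / 2))
      atTop (𝓝 0) := by
    simpa using ENNReal.Tendsto.div_const (ENNReal.Tendsto.const_mul
      (tendsto_lintegral_tsum_tsub h hφ hw_sum) (.inr hC_top)) (.inr hε_ne)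
  refine tendsto_of_tendsto_of_tendsto_of_le_of_le tendsto_const_nhds bound_lim
    (fun _ => zero_le) fun n => ?_
  calc ρ {ω | ENNReal.ofReal ε < minimalDist dist (κ n ω) μ}
      ≤ ρ {ω | ENNReal.ofReal (ε / 2) ≤ ENNReal.ofReal C * T n ω} := measure_mono fun ω hω => by
        have hle : ENNReal.ofReal ε ≤ ENNReal.ofReal (ε / 2) + ENNReal.ofReal C * T n ω :=
          hω.le.trans <| minimalDist_le_tsum hC hw hw_sum fun k x y hx hy =>
            hφ_diam k x y (hw_ne hx) (hw_ne hy)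
        nth_rewrite 1 [← add_halves ε] at hle
        rw [ENNReal.ofReal_add (half_pos hε).le (half_pos hε).le] at hle
        exact (ENNReal.add_le_add_iff_left ENNReal.ofReal_ne_top).1 hle
    _ ≤ (∫⁻ ω, ENNReal.ofReal C * T n ω ∂ρ) / ENNReal.ofReal (ε / 2) :=
        meas_ge_le_lintegral_div ((hT n).const_mul _).aemeasurable hε_ne ENNReal.ofReal_ne_top
    _ = ENNReal.ofReal C * (∫⁻ ω, T n ω ∂ρ) / ENNReal.ofReal (ε / 2) := by
        rw [lintegral_const_mul _ (hT n)]

end Convergence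

section IsMetric

variable {E : Type*} {d : E → E → ℝ}

/-- The metric space structure on `E` defined by `d`; its topology is in general coarser than the
given one. -/
abbrev IsMetric.toMetricSpace (hd : IsMetric d) : MetricSpace E where
  dist := d
  dist_self x := (hd.eq_zero_iff x x).2 rfl
  dist_comm := hd.symm
  dist_triangle := hd.triangle
  eq_of_dist_eq_zero {x y} := (hd.eq_zero_iff x y).1

/-- The topology on `E` defined by `d`. -/
abbrev IsMetric.topology (hd : IsMetric d) : TopologicalSpace E :=
  hd.toMetricSpace.toUniformSpace.toTopologicalSpace

variable [t : TopologicalSpace E]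

theorem IsMetric.le_topology (hd : IsMetric d) (hd_cont : Continuous fun z : E × E => d z.1 z.2) :
    t ≤ hd.topology :=
  le_of_nhds_le_nhds fun x =>
    (@Metric.nhds_basis_ball E hd.toMetricSpace.toPseudoMetricSpace x).ge_iff.2 fun ε hε => by
      have dist_cont : Continuous fun y => d y x := hd_cont.comp (.prodMk_left x)
      exact dist_cont.continuousAt.eventually_lt_const
        (((hd.eq_zero_iff x x).2 rfl).trans_lt hε)

theorem IsMetric.separableSpace [TopologicalSpace.SeparableSpace E] (hd : IsMetric d)
    (hd_cont : Continuous fun z : E × E => d z.1 z.2) :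
    @TopologicalSpace.SeparableSpace E hd.topology :=
  @DenseRange.separableSpace E E t _ hd.topology id (@denseRange_id E hd.topology)
    (continuous_id_iff_le.2 (hd.le_topology hd_cont))

theorem IsMetric.opensMeasurableSpace [MeasurableSpace E] [OpensMeasurableSpace E]
    (hd : IsMetric d) (hd_cont : Continuous fun z : E × E => d z.1 z.2) :
    @OpensMeasurableSpace E hd.topology _ :=
  @OpensMeasurableSpace.mk E hd.topology _
    ((borel_anti (hd.le_topology hd_cont)).trans OpensMeasurableSpace.borel_le)

end IsMetric

end GenCoupling

open GenCoupling in
theorem theorem2p3_general {E : Type*} [PseudoMetricSpace E] [TopologicalSpace.SeparableSpace E]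
    [BoundedSpace E] [MeasurableSpace E] [OpensMeasurableSpace E] (P : Kernel E E)
    [IsMarkovKernel P] :
    (∀ (μ : Measure E) [IsProbabilityMeasure μ], IsDFeller dist P → P.Invariant μ →
      (∀ᵐ z ∂μ.prod μ, CouplingCond dist P z.1 z.2) → ∀ ε : ℝ, 0 < ε →
        Tendsto (fun n : ℕ => μ {x | ENNReal.ofReal ε < minimalDist dist (nStep P n x) μ})
          atTop (𝓝 0)) ∧
    (∀ x y : E,
      (CouplingCond dist P x y ↔ ∃ p R : ℝ, 1 < p ∧ 1 ≤ R ∧ LpCouplingCond dist P p R x y) ∧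
      (GenCouplingCond dist P x y →
        (∃ p R : ℝ, 1 < p ∧ 1 ≤ R ∧ LpCouplingCond dist P p R x y) ∧ CouplingCond dist P x y)) := by
  have lp {x y : E} (h : CouplingCond dist P x y) :
      ∃ p R : ℝ, 1 < p ∧ 1 ≤ R ∧ LpCouplingCond dist P p R x y :=
    ⟨2, 1, one_lt_two, le_rfl, h.lpCouplingCond le_rfl⟩
  refine ⟨fun μ _ hP hμ h ε hε => tendsto_measure_minimalDist_gt
    (hP.tendsto_lintegral_enorm_sub_integral hμ h) hε, fun x y => ⟨⟨lp, ?_⟩, fun h =>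
      ⟨lp h.couplingCond, h.couplingCond⟩⟩⟩
  rintro ⟨p, R, hp, -, h⟩
  exact h.couplingCond hp

theorem theorem2p3 {E : Type*} [TopologicalSpace E] [PolishSpace E] [MeasurableSpace E]
    [BorelSpace E] (P : Kernel E E) [IsMarkovKernel P]
    (d : E → E → ℝ) (hd : GenCoupling.IsMetric d) (hd_bdd : ∃ C, ∀ x y, d x y ≤ C)
    (hd_cont : Continuous fun z : E × E => d z.1 z.2) :
    (∀ (μ : Measure E) [IsProbabilityMeasure μ], GenCoupling.IsDFeller d P → P.Invariant μ →
      ∀ M : Set (E × E), MeasurableSet M → (μ.prod μ) M = 1 →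
      (∀ z ∈ M, GenCoupling.CouplingCond d P z.1 z.2) →
      ∀ ε : ℝ, 0 < ε →
        Tendsto (fun n : ℕ =>
          μ {x | ENNReal.ofReal ε < GenCoupling.minimalDist d (GenCoupling.nStep P n x) μ})
          atTop (𝓝 0)) ∧
    (∀ x y : E,
      (GenCoupling.CouplingCond d P x y ↔
        ∃ p R : ℝ, 1 < p ∧ 1 ≤ R ∧ GenCoupling.LpCouplingCond d P p R x y) ∧
      (GenCoupling.GenCouplingCond d P x y →
        (∃ p R : ℝ, 1 < p ∧ 1 ≤ R ∧ GenCoupling.LpCouplingCond d P p R x y) ∧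
        GenCoupling.CouplingCond d P x y)) := by
  have separable := hd.separableSpace hd_cont
  have opens_measurable := hd.opensMeasurableSpace hd_cont
  let _ := hd.toMetricSpace
  have bounded : BoundedSpace E := Metric.boundedSpace_iff.2 hd_bdd
  obtain ⟨ergodic, equivalence⟩ := theorem2p3_general P
  exact ⟨fun μ _ hP hμ M hM hM1 h => ergodic μ hP hμ <|
    mem_of_superset ((prob_compl_eq_zero_iff hM).2 hM1) h, equivalence⟩
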